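/- Let $X$ be a connected topological space with exactly two path components, each of which is, in the subspace topology, simply connected and locally path-connected, and let $x_0, x_1$ be points in different path components of $X$. A \emph{bridge} joining two points of a space is an arc (a copy of $[0,1]$) glued to the space along its two endpoints, which are identified with the two given points; the resulting space carries the quotient topology. Let $X_2 = X \cup A \cup B$ be obtained from $X$ by adding two bridges $A$ and $B$, both joining $x_0$ and $x_1$. Let $\tilde X_2$ be obtained from $X \times \{0,1\}$ (where $\{0,1\}$ is discrete) by adding four bridges: $A_0$ joining $(x_0,0)$ and $(x_1,1)$, $A_1$ joining $(x_0,1)$ and $(x_1,0)$, $B_0$ joining $(x_0,0)$ and $(x_1,0)$, and $B_1$ joining $(x_0,1)$ and $(x_1,1)$. Let $p_1 : \tilde X_2 \to X_2$ be the natural extension of the projection $X \times \{0,1\} \to X$ which maps $A_0$ and $A_1$ homeomorphically onto $A$, and $B_0$ and $B_1$ homeomorphically onto $B$ (compatibly with the parametrizations by $[0,1]$ running from the point over $x_0$ to the point over $x_1$). Then, for all choices of base points, $\pi_1(X_2) \cong \mathbb{Z}$ and $\pi_1(\tilde X_2) \cong \mathbb{Z}$; and for every base point $e \in \tilde X_2$,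 the image of $\pi_1(p_1) : \pi_1(\tilde X_2, e) \to \pi_1(X_2, p_1(e))$ corresponds to $2\mathbb{Z}$ under every isomorphism $\pi_1(X_2, p_1(e)) \cong \mathbb{Z}$. -/

import Mathlib

namespace AnomalousCover

section Bridges

variable {Y Y' J J' : Type*}

/-- The gluing relation: the initial point of the `j`-th arc is identified with `s j`,
its terminal point with `t j`. -/
inductive BridgeRel (s t : J → Y) : Y ⊕ (Σ _ : J, unitInterval) → Y ⊕ (Σ _ : J, unitInterval) → Prop
  | initial (j : J) : BridgeRel s t (Sum.inr ⟨j, 0⟩) (Sum.inl (s j))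
  | terminal (j : J) : BridgeRel s t (Sum.inr ⟨j, 1⟩) (Sum.inl (t j))

/-- The space obtained from `Y` by adding, for every `j : J`, a bridge (an arc whose interior is
disjoint from `Y` and from the other bridges) joining `s j` to `t j`. -/
def Bridged (s t : J → Y) := Quot (BridgeRel s t)

/-- The quotient topology of the disjoint union of `Y` and `J` many copies of `[0, 1]`. -/
instance [TopologicalSpace Y] (s t : J → Y) : TopologicalSpace (Bridged s t) :=
  inferInstanceAs (TopologicalSpace (Quot (BridgeRel s t)))

/-- The inclusion of `Y`. -/
def Bridged.incl (s t : J → Y) (y : Y) : Bridged s t := Quot.mk _ (Sum.inl y)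

/-- The `j`-th bridge, parametrized by `[0, 1]`. -/
def Bridged.arc (s t : J → Y) (j : J) (r : unitInterval) : Bridged s t := Quot.mk _ (Sum.inr ⟨j, r⟩)

/-- The extension of a continuous map `f : Y → Y'` that sends the `j`-th bridge
homeomorphically (by the identity of `[0, 1]`) onto the bridge with index `g j`. -/
def Bridged.map [TopologicalSpace Y] [TopologicalSpace Y'] {s t : J → Y} {s' t' : J' → Y'}
    (f : C(Y, Y')) (g : J → J') (hs : ∀ j, f (s j) = s' (g j)) (ht : ∀ j, f (t j) = t' (g j)) :
    C(Bridged s t, Bridged s' t') where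
  toFun := Quot.lift
    (Sum.elim (fun y => Bridged.incl s' t' (f y)) (fun q => Bridged.arc s' t' (g q.1) q.2)) <| by
      rintro _ _ (j | j)
      · exact (Quot.sound (BridgeRel.initial (g j))).trans (congrArg (Bridged.incl s' t') (hs j).symm)
      · exact (Quot.sound (BridgeRel.terminal (g j))).trans (congrArg (Bridged.incl s' t') (ht j).symm)
  continuous_toFun := by
    refine continuous_quot_lift _ (Continuous.sumElim ?_ ?_)
    · exact continuous_quot_mk.comp (continuous_inl.comp f.continuous)
    · refine continuous_sigma fun j => ?_
      exact continuous_quot_mk.comp (continuous_inr.comp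
        (continuous_sigmaMk (σ := fun _ : J' => unitInterval) (i := g j)))

end Bridges

/-- Labels of the bridges of the base space. -/
inductive BaseBridge
  | A
  | B

/-- Labels of the bridges of the covering space. -/
inductive CoverBridge
  | A₀
  | A₁
  | B₀
  | B₁

/-- `A₀` and `A₁` lie over `A`; `B₀` and `B₁` lie over `B`. -/
def CoverBridge.proj : CoverBridge → BaseBridge
  | A₀ => .A
  | A₁ => .A
  | B₀ => .B
  | B₁ => .B

section Spaces

variable {X : Type*}

/-- Initial points of the bridges of the covering space. -/
def coverStart (x₀ : X) : CoverBridge → X × Fin 2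
  | .A₀ => (x₀, 0)
  | .A₁ => (x₀, 1)
  | .B₀ => (x₀, 0)
  | .B₁ => (x₀, 1)

/-- Terminal points of the bridges of the covering space. -/
def coverEnd (x₁ : X) : CoverBridge → X × Fin 2
  | .A₀ => (x₁, 1)
  | .A₁ => (x₁, 0)
  | .B₀ => (x₁, 0)
  | .B₁ => (x₁, 1)

/-- `X₂ = X ∪ A ∪ B`, where `A` and `B` are bridges joining `x₀` and `x₁`. -/
abbrev X2 (x₀ x₁ : X) :=
  Bridged (fun _ : BaseBridge => x₀) (fun _ : BaseBridge => x₁)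

/-- The space `X × {0, 1}` with the four bridges `A₀, A₁, B₀, B₁` added. -/
abbrev X2Cover (x₀ x₁ : X) :=
  Bridged (coverStart x₀) (coverEnd x₁)

/-- The projection `p₁`, extending `X × {0, 1} → X` and sending `A₀, A₁` onto `A` and
`B₀, B₁` onto `B`. -/
def p1 [TopologicalSpace X] (x₀ x₁ : X) : C(X2Cover x₀ x₁, X2 x₀ x₁) :=
  Bridged.map ContinuousMap.fst CoverBridge.proj
    (fun j => by cases j <;> rfl) (fun j => by cases j <;> rfl)

end Spaces

end AnomalousCover

/-!
Fix path classes from a base point to the points of the original space `Y`, compatible with the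
paths in `Y`. Given a subgroup `H` of the fundamental group of the bridged space that contains the
loops over all bridges, the associated covering is trivial over `Y` and over each bridge, so that
every path class respects the resulting cosets of `H`, and `H` is everything. Hence the bridge loops
generate. Choosing the path classes along a spanning tree of bridges leaves a single loop that
crosses the remaining bridge. Mapping `Y` to a point and wrapping `A` once around the circle, this
loop has winding number one in `X2`; in the cover it crosses both lifts of `A` in the same
direction, so its image has winding number two.
-/

namespace AnomalousCover

open Set Topology unitInterval CategoryTheory

section CyclicGroup

theorem nonempty_mulEquiv_int {G M : Type*} [Group G] [Group M] [IsMulTorsionFree M] {k : G}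
    (hk : Subgroup.zpowers k = ⊤) (φ : G →* M) (hφ : φ k ≠ 1) :
    Nonempty (G ≃* Multiplicative ℤ) := by
  have : Infinite G := not_finite_iff_infinite.1 fun _ =>
    not_isOfFinOrder_of_isMulTorsionFree hφ (φ.isOfFinOrder (isOfFinOrder_of_finite k))
  exact ⟨(intEquivOfZPowersEqTop k hk).symm⟩

theorem zpowers_zpow_mono {G : Type*} [Group G] {k k' : G}
    (h : Subgroup.zpowers k ≤ Subgroup.zpowers k') (n : ℤ) :
    Subgroup.zpowers (k ^ n) ≤ Subgroup.zpowers (k' ^ n) := by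
  rw [Subgroup.zpowers_le] at h ⊢
  obtain ⟨m, rfl⟩ := h
  exact ⟨m, zpow_comm k' n m⟩

theorem zpowers_apply_eq_top {G G' : Type*} [Group G] [Group G'] (φ : G ≃* G') {k : G}
    (hk : Subgroup.zpowers k = ⊤) : Subgroup.zpowers (φ k) = ⊤ := by
  rw [← MonoidHom.coe_coe, ← MonoidHom.map_zpowers, hk]
  exact Subgroup.map_top_of_surjective _ φ.surjective

theorem map_zpowers_zpow_eq {G : Type*} [Group G] {k : G} (hk : Subgroup.zpowers k = ⊤)
    (φ : G ≃* Multiplicative ℤ) (n : ℤ) :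
    (Subgroup.zpowers (k ^ n)).map φ.toMonoidHom = Subgroup.zpowers (Multiplicative.ofAdd n) := by
  have hpow (m : ℤ) : Multiplicative.ofAdd (1 : ℤ) ^ m = Multiplicative.ofAdd m := by
    rw [← ofAdd_zsmul, smul_eq_mul, mul_one]
  have h : Subgroup.zpowers (φ k) = Subgroup.zpowers (Multiplicative.ofAdd 1) :=
    (zpowers_apply_eq_top φ hk).trans
      ((Subgroup.eq_top_iff' _).2 fun m => Subgroup.mem_zpowers_iff.2 ⟨m.toAdd, hpow m.toAdd⟩).symm
  rw [MonoidHom.map_zpowers, map_zpow, ← hpow n]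
  exact (zpowers_zpow_mono h.le n).antisymm (zpowers_zpow_mono h.ge n)

end CyclicGroup

section Coset

variable {C : Type*} [Groupoid C] {c d d' : C} (H : Subgroup (End c))

/-- The arrows that agree with the arrow `r` up to an element of the subgroup `H` of the vertex
group at the source: a point over the target in the covering associated with `H`. -/
def endCoset (r : c ⟶ d) : Set (c ⟶ d) := {p | p ≫ Groupoid.inv r ∈ H}

variable {H}

theorem self_mem_endCoset (r : c ⟶ d) : r ∈ endCoset H r := by
  rw [endCoset, mem_ofPred, Groupoid.comp_inv]
  exact H.one_mem

theorem comp_mem_endCoset_iff {p r : c ⟶ d} {q : d ⟶ d'} {r' : c ⟶ d'} (h : r ≫ q = r') :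
    p ≫ q ∈ endCoset H r' ↔ p ∈ endCoset H r := by
  simp [endCoset, ← h]

theorem endCoset_heq (h : d = d') {r : c ⟶ d} {r' : c ⟶ d'}
    (hr : r ≫ eqToHom h ≫ Groupoid.inv r' ∈ H) : HEq (endCoset H r) (endCoset H r') := by
  subst h
  refine heq_of_eq (Set.ext fun p => ?_)
  have key : p ≫ Groupoid.inv r' = (p ≫ Groupoid.inv r) ≫ r ≫ Groupoid.inv r' := by simp
  rw [eqToHom_refl, Category.id_comp] at hr
  simp only [endCoset, mem_ofPred, key]
  exact (H.mul_mem_cancel_left hr).symm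

/-- The arrows that map the members of a family of sets of arrows from `c` onto each other. -/
def transporter (K : ∀ d, Set (c ⟶ d)) : Subgroupoid C where
  arrows d d' := {q | ∀ p, p ≫ q ∈ K d' ↔ p ∈ K d}
  inv hq p := by simp [← hq (p ≫ _)]
  mul hq _ hq' p := by rw [← Category.assoc, hq', hq]

end Coset

section PathClass

variable {Z W : Type*} [TopologicalSpace Z] [TopologicalSpace W]

/-- The homotopy class of a path, as a morphism of the fundamental groupoid. -/
abbrev pathClass {a b : Z} (w : Path a b) : FundamentalGroupoid.mk a ⟶ FundamentalGroupoid.mk b :=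
  FundamentalGroupoid.fromPath (.mk w)

theorem pathClass_eq_of_homotopic {a b : Z} {w w' : Path a b} (h : w.Homotopic w') :
    pathClass w = pathClass w' :=
  Path.Homotopic.Quotient.eq.2 h

variable {S : Subgroupoid (FundamentalGroupoid Z)}

theorem pathClass_mem_of_apply_eq {a b a' b' : Z} {w : Path a b} {w' : Path a' b'}
    (h : ∀ u, w u = w' u) (hw' : pathClass w' ∈ S.arrows _ _) : pathClass w ∈ S.arrows _ _ := by
  obtain rfl : a = a' := by simpa using h 0
  obtain rfl : b = b' := by simpa using h 1
  obtain rfl : w = w' := Path.ext (funext h)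
  exact hw'

theorem pathClass_mem_of_range_subset_range {e : C(W, Z)} (he : IsInducing e)
    (hS : S.comap (FundamentalGroupoid.map e) = ⊤) {a b : Z} (w : Path a b)
    (hw : range w ⊆ range e) : pathClass w ∈ S.arrows _ _ := by
  choose v hv using fun u => hw (mem_range_self u)
  have hvc : Continuous v := he.continuous_iff.2 (by simpa only [funext hv, Function.comp_def]
    using w.continuous)
  let w' : Path (v 0) (v 1) := ⟨⟨v, hvc⟩, rfl, rfl⟩
  have hw' : pathClass w' ∈ (S.comap (FundamentalGroupoid.map e)).arrows _ _ :=
    hS ▸ Subgroupoid.mem_top _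
  exact pathClass_mem_of_apply_eq (w' := w'.map e.continuous) (fun u => (hv u).symm) hw'

theorem pathClass_mem_iff_map_mem {f : C(Z, Z)} (F : (ContinuousMap.id Z).Homotopy f)
    (hF : ∀ z, pathClass (F.evalAt z) ∈ S.arrows _ _) {a b : Z} (w : Path a b) :
    pathClass w ∈ S.arrows _ _ ↔ pathClass (w.map f.continuous) ∈ S.arrows _ _ := by
  have naturality : pathClass w ≫ pathClass (F.evalAt b) =
      pathClass (F.evalAt a) ≫ pathClass (w.map f.continuous) :=
    pathClass_eq_of_homotopic (Path.Homotopic.map_trans_evalAt F w)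
  exact (S.mul_mem_cancel_right (hF b)).symm.trans
    (naturality ▸ S.mul_mem_cancel_left (hF a))

theorem subgroupoid_eq_top_of_iUnion_eq_univ {ι : Type*} {U : ι → Set Z}
    (hU : ∀ i, IsOpen (U i)) (hcover : ⋃ i, U i = univ)
    (hS : ∀ i {a b : Z} (w : Path a b), range w ⊆ U i → pathClass w ∈ S.arrows _ _) : S = ⊤ := by
  refine top_unique ((Subgroupoid.le_iff _ _).2 fun {a b} q _ => ?_)
  induction q using Path.Homotopic.Quotient.ind with
  | mk w =>
    obtain ⟨d, hd₀, hmono, ⟨n, hn⟩, hd⟩ := exists_monotone_Icc_subset_open_cover_unitInterval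
      (fun i => (hU i).preimage w.continuous) (by rw [← preimage_iUnion, hcover, preimage_univ])
    have hpiece (m : ℕ) : pathClass (w.subpath (d m) (d (m + 1))) ∈ S.arrows _ _ := by
      obtain ⟨i, hi⟩ := hd m
      refine hS i _ ?_
      rw [Path.range_subpath_of_le _ _ _ (hmono m.le_succ)]
      exact image_subset_iff.2 hi
    have hinitial (m : ℕ) : pathClass (w.subpath (d 0) (d m)) ∈ S.arrows _ _ := by
      induction m with
      | zero =>
        rw [Path.subpath_self]
        exact S.id_mem_of_src (hpiece 0)
      | succ m ih =>
        rw [← pathClass_eq_of_homotopic ⟨Path.Homotopy.subpathTransSubpath w (d 0) (d m) _⟩]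
        exact S.mul ih (hpiece m)
    refine pathClass_mem_of_apply_eq (fun u => ?_) (hinitial n)
    rw [hd₀, hn n le_rfl, Path.subpath_zero_one, Path.cast_coe]

end PathClass

section Thin

theorem isThin_of_forall_homotopic {Z : Type*} [TopologicalSpace Z]
    (h : ∀ {x y : Z} (p q : Path x y), p.Homotopic q) :
    Quiver.IsThin (FundamentalGroupoid Z) := fun _ _ =>
  ⟨Path.Homotopic.Quotient.ind₂ fun p q => Path.Homotopic.Quotient.eq.2 (h p q)⟩

instance isThin_fundamentalGroupoid {Z : Type*} [TopologicalSpace Z] [SimplyConnectedSpace Z] :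
    Quiver.IsThin (FundamentalGroupoid Z) :=
  isThin_of_forall_homotopic SimplyConnectedSpace.paths_homotopic

instance simplyConnectedSpace_unitInterval : SimplyConnectedSpace I :=
  have : ContractibleSpace I := (convex_Icc (0 : ℝ) 1).contractibleSpace ⟨0, by simp⟩
  inferInstance

theorem exists_natTrans_const_of_isThin {G C V : Type*} [Groupoid G] [Quiver.IsThin G] [Category C]
    {rep : V → G} (hrep : ∀ g, ∃! v, Nonempty (rep v ⟶ g)) (F : G ⥤ C) {c : C}
    (S : ∀ v, c ⟶ F.obj (rep v)) :
    ∃ τ : (Functor.const G).obj c ⟶ F, ∀ v, τ.app (rep v) = S v := by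
  choose v γ huniq using hrep
  have key {g : G} {w w' : V} (p : rep w ⟶ g) (p' : rep w' ⟶ g) :
      S w ≫ F.map p = S w' ≫ F.map p' := by
    obtain rfl := (huniq g w ⟨p⟩).trans (huniq g w' ⟨p'⟩).symm
    rw [Subsingleton.elim p p']
  refine ⟨⟨fun g => S (v g) ≫ F.map (γ g).some, fun g g' q => ?_⟩, fun w => ?_⟩
  · calc 𝟙 c ≫ S (v g') ≫ F.map (γ g').some = S (v g) ≫ F.map ((γ g).some ≫ q) :=
          (Category.id_comp _).trans (key _ _)
      _ = (S (v g) ≫ F.map (γ g).some) ≫ F.map q := by rw [F.map_comp, Category.assoc]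
  · exact (key _ (𝟙 _)).trans (by simp)

variable {X D : Type*} [TopologicalSpace X] [TopologicalSpace D]

theorem isThin_of_simplyConnectedSpace_pathComponent
    (h : ∀ x : X, SimplyConnectedSpace (pathComponent x)) :
    Quiver.IsThin (FundamentalGroupoid X) := by
  refine isThin_of_forall_homotopic fun {x y} p q => ?_
  have hy : y ∈ pathComponent x := ⟨p⟩
  let lift (p : Path x y) : Path (⟨x, mem_pathComponent_self x⟩ : pathComponent x) ⟨y, hy⟩ :=
    ⟨⟨fun u => ⟨p u, ⟨(p.subpath 0 u).cast p.source.symm rfl⟩⟩, by fun_prop⟩,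
      Subtype.ext p.source, Subtype.ext p.target⟩
  have := h x
  exact (SimplyConnectedSpace.paths_homotopic (lift p) (lift q)).map
    ⟨Subtype.val, continuous_subtype_val⟩

theorem path_apply_eq [TotallyDisconnectedSpace D] {d d' : D} (p : Path d d') (u u' : I) :
    p u = p u' :=
  (isPreconnected_range p.continuous).subsingleton (mem_range_self u) (mem_range_self u')

theorem joined_iff_eq [TotallyDisconnectedSpace D] {d d' : D} : Joined d d' ↔ d = d' :=
  ⟨fun ⟨p⟩ => by simpa using path_apply_eq p 0 1, fun h => h ▸ .refl d⟩

instance isThin_fundamentalGroupoid_of_totallyDisconnectedSpace [TotallyDisconnectedSpace D] :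
    Quiver.IsThin (FundamentalGroupoid D) :=
  isThin_of_forall_homotopic fun p q => by
    obtain rfl : p = q := Path.ext <| funext fun u =>
      (path_apply_eq p u 0).trans <| (p.source.trans q.source.symm).trans (path_apply_eq q 0 u)
    rfl

instance isThin_fundamentalGroupoid_prod [Quiver.IsThin (FundamentalGroupoid X)]
    [Quiver.IsThin (FundamentalGroupoid D)] : Quiver.IsThin (FundamentalGroupoid (X × D)) := by
  refine fun a b => ⟨fun p q => ?_⟩
  rw [← Path.Homotopic.prod_projLeft_projRight p, ← Path.Homotopic.prod_projLeft_projRight q]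
  exact congrArg₂ Path.Homotopic.prod
    (Subsingleton.elim (α := FundamentalGroupoid.mk a.as.1 ⟶ .mk b.as.1) _ _)
    (Subsingleton.elim (α := FundamentalGroupoid.mk a.as.2 ⟶ .mk b.as.2) _ _)

theorem existsUnique_joined_prod [TotallyDisconnectedSpace D] {V : Type*} {rep : V → X}
    (hrep : ∀ x, ∃! v, Joined (rep v) x) (y : X × D) :
    ∃! w : V × D, Joined (rep w.1, w.2) y := by
  obtain ⟨v, hv, huniq⟩ := hrep y.1
  exact ⟨(v, y.2), hv.prod (.refl _), fun w hw =>
    Prod.ext (huniq _ (hw.map continuous_fst)) (joined_iff_eq.1 (hw.map continuous_snd))⟩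

theorem existsUnique_joined_of_card_zerothHomotopy_eq_two
    (h : Nat.card (ZerothHomotopy X) = 2) {x₀ x₁ : X} (h_ne : ¬ Joined x₀ x₁) (x : X) :
    ∃! v, Joined (![x₀, x₁] v) x := by
  have hjoined {y z : X} : ZerothHomotopy.mk y = ZerothHomotopy.mk z ↔ Joined y z := Quotient.eq
  have hinj : Function.Injective fun v => ZerothHomotopy.mk (![x₀, x₁] v) := by
    intro v w hvw
    rw [hjoined] at hvw
    fin_cases v <;> fin_cases w
    exacts [rfl, (h_ne hvw).elim, (h_ne hvw.symm).elim, rfl]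
  have : Finite (ZerothHomotopy X) := Nat.finite_of_card_ne_zero (h ▸ two_ne_zero)
  have hbij := hinj.bijective_of_nat_card_le (by simp [h])
  simpa only [hjoined] using hbij.existsUnique (.mk x)

end Thin

section Displacement

variable {𝕜 : Type*} [AddCommGroup 𝕜] [TopologicalSpace 𝕜] [IsTopologicalAddGroup 𝕜] (p : 𝕜)
  [DiscreteTopology (AddSubgroup.zmultiples p)]

theorem monodromy_coe_sub_eq {a b : AddCircle p} (q : Path.Homotopic.Quotient a b)
    (e e' : ((↑) : 𝕜 → AddCircle p) ⁻¹' {a}) :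
    ((AddCircle.isCoveringMap_coe p).monodromy q e : 𝕜) - e =
      (AddCircle.isCoveringMap_coe p).monodromy q e' - e' := by
  let cov := AddCircle.isAddQuotientCoveringMap_coe p
  obtain ⟨g, rfl⟩ := cov.toMultiplicative.exists_toPermFiber_eq e' e
  have hg : ((AddCircle.isCoveringMap_coe p).monodromy q
      (cov.toMultiplicative.toPermFiber a g e') : 𝕜) =
        g.toAdd + (AddCircle.isCoveringMap_coe p).monodromy q e' :=
    congrArg Subtype.val (cov.monodromy_toPermFiber (g := g.toAdd))
  rw [hg]
  exact add_sub_add_left_eq_sub _ _ _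

/-- The difference of the end points of a lift of a path in the circle, as a functor on path
classes. The lift is made to start at a chosen representative of the initial point. -/
noncomputable def displacement :
    FundamentalGroupoid (AddCircle p) ⥤ SingleObj (Multiplicative 𝕜) where
  obj _ := SingleObj.star _
  map {a _} q := .ofAdd
    ((AddCircle.isCoveringMap_coe p).monodromy q ⟨a.as.out, QuotientAddGroup.out_eq' _⟩ - a.as.out)
  map_id a := congrArg Multiplicative.ofAdd <| sub_eq_zero.2 <| congrArg Subtype.val <|
    congrFun ((AddCircle.isCoveringMap_coe p).monodromy_refl (x := a.as)) _
  map_comp {a b c} q q' := by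
    let e (x : AddCircle p) : ((↑) : 𝕜 → AddCircle p) ⁻¹' {x} :=
      ⟨x.out, QuotientAddGroup.out_eq' x⟩
    let e' := (AddCircle.isCoveringMap_coe p).monodromy q (e a.as)
    refine congrArg Multiplicative.ofAdd (?_ : _ = _ - (e b.as : 𝕜) + (e' - e a.as))
    rw [monodromy_coe_sub_eq p q' (e b.as) e', sub_add_sub_cancel,
      ← IsCoveringMap.monodromy_trans_apply]
    rfl

variable {p}

theorem displacement_map_eq {a b : FundamentalGroupoid (AddCircle p)} (q : a ⟶ b)
    (e : ((↑) : 𝕜 → AddCircle p) ⁻¹' {a.as}) : (displacement p).map q =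
      .ofAdd (((AddCircle.isCoveringMap_coe p).monodromy q e : 𝕜) - e) :=
  congrArg Multiplicative.ofAdd (monodromy_coe_sub_eq p q _ e)

theorem displacement_map_coe {x y : FundamentalGroupoid 𝕜} (q : x ⟶ y) :
    (displacement p).map ((FundamentalGroupoid.map ⟨_, AddCircle.continuous_mk' p⟩).map q) =
      Multiplicative.ofAdd (y.as - x.as) :=
  (displacement_map_eq _ ⟨x.as, rfl⟩).trans <|
    congrArg (fun e => Multiplicative.ofAdd (Subtype.val e - x.as))
      ((AddCircle.isCoveringMap_coe p).monodromy_map q)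

end Displacement

section Winding

variable {Z W : Type*} [TopologicalSpace Z] [TopologicalSpace W] (f : C(Z, AddCircle (1 : ℝ)))
  {z z' z'' : FundamentalGroupoid Z}

/-- The net change, in full turns, of a map to the circle along a path class. -/
noncomputable def winding (q : z ⟶ z') : ℝ :=
  Multiplicative.toAdd ((displacement 1).map ((FundamentalGroupoid.map f).map q))

variable {f}

theorem winding_comp (q : z ⟶ z') (q' : z' ⟶ z'') :
    winding f (q ≫ q') = winding f q + winding f q' := by
  rw [winding, Functor.map_comp, Functor.map_comp]
  exact add_comm _ _

theorem winding_id : winding f (𝟙 z) = 0 := by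
  rw [← add_eq_left (a := winding f (𝟙 z)), ← winding_comp, Category.comp_id]

theorem winding_inv (q : z ⟶ z') : winding f (Groupoid.inv q) = -winding f q := by
  rw [eq_neg_iff_add_eq_zero, ← winding_comp, Groupoid.inv_comp, winding_id]

theorem winding_eqToHom (h : z = z') : winding f (eqToHom h) = 0 := by
  subst h
  exact winding_id

theorem winding_conj (e : z ≅ z') (q : End z) : winding f (e.conj q) = winding f q := by
  rw [Iso.conj_apply, winding_comp, winding_comp, add_left_comm, ← winding_comp, e.inv_hom_id,
    winding_id, add_zero]

variable (f) in
/-- The winding of loops as a homomorphism. -/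
noncomputable def windingHom (z : FundamentalGroupoid Z) : End z →* Multiplicative ℝ where
  toFun q := .ofAdd (winding f q)
  map_one' := congrArg Multiplicative.ofAdd winding_id
  map_mul' q q' := congrArg Multiplicative.ofAdd ((winding_comp q' q).trans (add_comm _ _))

theorem winding_zpow (q : End z) (n : ℤ) : winding f (q ^ n) = n * winding f q := by
  have h := congrArg Multiplicative.toAdd (map_zpow (windingHom f z) q n)
  rwa [toAdd_zpow, zsmul_eq_mul] at h

theorem winding_map (g : C(W, Z)) {w w' : FundamentalGroupoid W} (q : w ⟶ w') :
    winding f ((FundamentalGroupoid.map g).map q) = winding (f.comp g) q :=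
  congrArg (fun q => Multiplicative.toAdd ((displacement 1).map q))
    Path.Homotopic.Quotient.map_comp.symm

theorem winding_coe_comp (g : C(Z, ℝ)) (q : z ⟶ z') :
    winding (.comp ⟨_, AddCircle.continuous_mk' 1⟩ g) q = g z'.as - g z.as := by
  rw [← winding_map]
  exact congrArg Multiplicative.toAdd (displacement_map_coe _)

end Winding

namespace Bridged

section Points

variable {Y J Z : Type*} {s t : J → Y}

theorem arc_zero (j : J) : arc s t j 0 = incl s t (s j) := Quot.sound (.initial j)

theorem arc_one (j : J) : arc s t j 1 = incl s t (t j) := Quot.sound (.terminal j)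

@[elab_as_elim, induction_eliminator]
protected theorem ind {p : Bridged s t → Prop} (incl : ∀ y, p (incl s t y))
    (arc : ∀ j r, p (arc s t j r)) (z : Bridged s t) : p z :=
  Quot.ind (Sum.rec incl fun q => arc q.1 q.2) z

/-- The function on a bridged space given by a function on the original space and functions on
the bridges that agree at the end points. -/
def desc (f : Y → Z) (g : J → I → Z) (h₀ : ∀ j, g j 0 = f (s j)) (h₁ : ∀ j, g j 1 = f (t j)) :
    Bridged s t → Z :=
  Quot.lift (Sum.elim f fun q => g q.1 q.2) <| by
    rintro _ _ (j | j)
    · exact h₀ j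
    · exact h₁ j

theorem image_arc (j : J) {V : Set I} (h₀ : 0 ∉ V) (h₁ : 1 ∉ V) :
    arc s t j '' V = {z | desc (fun _ => False) (fun j' r => j' = j ∧ r ∈ V)
      (by simp [h₀]) (by simp [h₁]) z} := by
  refine Subset.antisymm ?_ fun z => ?_
  · rintro _ ⟨r, hr, rfl⟩
    exact ⟨rfl, hr⟩
  · induction z with
    | incl y => exact False.elim
    | arc j' r =>
      rintro ⟨rfl, hr⟩
      exact mem_image_of_mem _ hr

theorem arc_injOn (j : J) : InjOn (arc s t j) (Ioo 0 1) := by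
  intro r hr r' _ h
  have hmem : arc s t j r' ∈ arc s t j '' {r} := ⟨r, rfl, h⟩
  rw [image_arc j hr.1.ne hr.2.ne'] at hmem
  exact hmem.2.symm

variable (s t) in
/-- The complement of the closed middle thirds of the bridges. -/
def outer : Set (Bridged s t) :=
  {z | desc (fun _ => True) (fun _ r => (r : ℝ) < 1 / 3 ∨ 2 / 3 < (r : ℝ))
    (fun _ => by norm_num) (fun _ => by norm_num) z}

theorem outer_union_iUnion_arc_Ioo :
    outer s t ∪ ⋃ j, arc s t j '' Ioo 0 1 = univ := by
  refine eq_univ_of_forall fun z => ?_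
  induction z with
  | incl y => exact Or.inl trivial
  | arc j r =>
    by_cases hr : (r : ℝ) < 1 / 3 ∨ 2 / 3 < (r : ℝ)
    · exact Or.inl hr
    · push Not at hr
      refine Or.inr (mem_iUnion.2 ⟨j, r, ⟨?_, ?_⟩, rfl⟩)
      · exact Subtype.coe_lt_coe.1 (by push_cast; linarith)
      · exact Subtype.coe_lt_coe.1 (by push_cast; linarith)

end Points

section Topology

variable {Y J Z : Type*} [TopologicalSpace Y] [TopologicalSpace Z] {s t : J → Y}

theorem continuous_incl : Continuous (incl s t) := continuous_quot_mk.comp continuous_inl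

theorem continuous_arc (j : J) : Continuous (arc s t j) :=
  continuous_quot_mk.comp (continuous_inr.comp (continuous_sigmaMk (ι := J) (i := j)))

variable (s t) in
/-- The inclusion of the original space into the bridged space as a continuous map. -/
def inclMap : C(Y, Bridged s t) := ⟨incl s t, continuous_incl⟩

variable (s t) in
/-- The parametrization of a bridge as a continuous map. -/
def arcMap (j : J) : C(I, Bridged s t) := ⟨arc s t j, continuous_arc j⟩

theorem continuous_desc {f : Y → Z} {g : J → I → Z} {h₀ : ∀ j, g j 0 = f (s j)}
    {h₁ : ∀ j, g j 1 = f (t j)} (hf : Continuous f) (hg : ∀ j, Continuous (g j)) :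
    Continuous (desc f g h₀ h₁ : Bridged s t → Z) :=
  continuous_quot_lift _ (hf.sumElim (continuous_sigma hg))

theorem isOpen_iff {U : Set (Bridged s t)} :
    IsOpen U ↔ IsOpen (incl s t ⁻¹' U) ∧ ∀ j, IsOpen (arc s t j ⁻¹' U) := by
  refine isQuotientMap_quot_mk.isOpen_preimage.symm.trans ?_
  rw [isOpen_sum_iff, isOpen_sigma_iff]
  rfl

theorem isInducing_incl : IsInducing (incl s t) := by
  refine isInducing_iff_nhds.2 fun y => le_antisymm continuous_incl.continuousAt.le_comap ?_
  intro N hN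
  obtain ⟨V, hVN, hV, hyV⟩ := mem_nhds_iff.1 hN
  -- `V` together with the halves of the bridges that end in `V`
  let U : Set (Bridged s t) := {z | desc (· ∈ V)
    (fun j r => ((r : ℝ) < 1 / 2 ∧ s j ∈ V) ∨ (1 / 2 < (r : ℝ) ∧ t j ∈ V))
    (fun _ => by norm_num) (fun _ => by norm_num) z}
  have hU : IsOpen U := isOpen_iff.2 ⟨hV, fun j => IsOpen.union
    (.and (isOpen_lt continuous_subtype_val continuous_const) (isOpen_const (p := s j ∈ V)))
    (.and (isOpen_lt continuous_const continuous_subtype_val) (isOpen_const (p := t j ∈ V)))⟩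
  exact ⟨U, hU.mem_nhds hyV, hVN⟩

theorem isOpenEmbedding_arc_Ioo (j : J) :
    IsOpenEmbedding ((Ioo (0 : I) 1).domRestrict (arc s t j)) := by
  refine .of_continuous_injective_isOpenMap ((continuous_arc j).comp continuous_subtype_val)
    (arc_injOn j).injective fun W hW => ?_
  have hV : IsOpen (Subtype.val '' W) := isOpen_Ioo.isOpenMap_subtype_val W hW
  have h₀ : (0 : I) ∉ Subtype.val '' W := by simp
  have h₁ : (1 : I) ∉ Subtype.val '' W := by simp
  rw [domRestrict_eq, image_comp, image_arc j h₀ h₁, isOpen_iff]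
  exact ⟨isOpen_empty, fun j' => (isOpen_const (p := j' = j)).inter hV⟩

end Topology

section Reparametrization

variable {Y J : Type*} [TopologicalSpace Y] {s t : J → Y} (φ : C(I, I)) (h₀ : φ 0 = 0)
  (h₁ : φ 1 = 1)

/-- The map that applies a reparametrization of the interval to all bridges. -/
def reparam : C(Bridged s t, Bridged s t) where
  toFun := desc (incl s t) (fun j r => arc s t j (φ r)) (fun j => by rw [h₀, arc_zero])
    (fun j => by rw [h₁, arc_one])
  continuous_toFun := continuous_desc continuous_incl fun j =>
    (continuous_arc j).comp φ.continuous

/-- The tracks of the homotopy from the identity to a reparametrization of all bridges. They are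
collected in a map to the path space, so that its continuity can be checked on the bridges. -/
def reparamTrack : C(Bridged s t, C(I, Bridged s t)) where
  toFun := desc (fun y => .const I (incl s t y))
    (fun j r => (arcMap s t j).comp ⟨_, Icc.continuous_convexComb r (φ r)⟩)
    (fun j => by ext u; simp [h₀, arcMap, arc_zero])
    (fun j => by ext u; simp [h₁, arcMap, arc_one])
  continuous_toFun := by
    refine continuous_desc (ContinuousMap.continuous_const'.comp continuous_incl) fun j => ?_
    refine ContinuousMap.continuous_of_continuous_uncurry _ ((continuous_arc j).comp ?_)
    exact Icc.continuous_convexComb_prod.comp (continuous_fst.prodMk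
      ((φ.continuous.comp continuous_fst).prodMk continuous_snd))

/-- The homotopy from the identity to a reparametrization of all bridges. -/
def reparamHomotopy : (ContinuousMap.id (Bridged s t)).Homotopy (reparam φ h₀ h₁) where
  toFun q := reparamTrack φ h₀ h₁ q.2 q.1
  map_zero_left z := by
    induction z with
    | incl y => rfl
    | arc j r => exact congrArg (arc s t j) (Icc.convexComb_zero r (φ r))
  map_one_left z := by
    induction z with
    | incl y => rfl
    | arc j r => exact congrArg (arc s t j) (Icc.convexComb_one r (φ r))

end Reparametrization

section Generation

variable {Y J : Type*} [TopologicalSpace Y] {s t : J → Y}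

variable (s t) in
/-- The inclusion of the original space on path classes. -/
abbrev inclFunctor : FundamentalGroupoid Y ⥤ FundamentalGroupoid (Bridged s t) :=
  FundamentalGroupoid.map (inclMap s t)

variable (s t) in
/-- The parametrization of a bridge on path classes. -/
abbrev arcFunctor (j : J) : FundamentalGroupoid I ⥤ FundamentalGroupoid (Bridged s t) :=
  FundamentalGroupoid.map (arcMap s t j)

/-- The map of the unit interval that collapses the first and the last third. -/
noncomputable def stretch : C(I, I) :=
  ⟨fun r => projIcc 0 1 zero_le_one (3 * (r : ℝ) - 1), by fun_prop⟩

theorem stretch_of_le {r : I} (h : (r : ℝ) ≤ 1 / 3) : stretch r = 0 :=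
  projIcc_of_le_left zero_le_one (by linarith)

theorem stretch_of_ge {r : I} (h : 2 / 3 ≤ (r : ℝ)) : stretch r = 1 :=
  projIcc_of_right_le zero_le_one (by linarith)

theorem isOpen_outer : IsOpen (outer s t) :=
  isOpen_iff.2 ⟨isOpen_univ, fun _ => IsOpen.union
    (isOpen_lt continuous_subtype_val continuous_const)
    (isOpen_lt continuous_const continuous_subtype_val)⟩

variable (s t) in
/-- The map that stretches the middle third of every bridge over the whole bridge. -/
noncomputable def stretchMap : C(Bridged s t, Bridged s t) :=
  reparam stretch (stretch_of_le (by norm_num)) (stretch_of_ge (by norm_num))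

variable (s t) in
/-- The homotopy from the identity to `stretchMap`. -/
noncomputable def stretchHomotopy :
    (ContinuousMap.id (Bridged s t)).Homotopy (stretchMap s t) :=
  reparamHomotopy _ _ _

theorem stretchMap_mem_range_incl {z : Bridged s t} (hz : z ∈ outer s t) :
    stretchMap s t z ∈ range (incl s t) := by
  induction z with
  | incl y => exact ⟨y, rfl⟩
  | arc j r =>
    change arc s t j (stretch r) ∈ range (incl s t)
    rcases hz with hr | hr
    · exact ⟨s j, by rw [stretch_of_le hr.le, arc_zero]⟩
    · exact ⟨t j, by rw [stretch_of_ge hr.le, arc_one]⟩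

theorem subgroupoid_eq_top {S : Subgroupoid (FundamentalGroupoid (Bridged s t))}
    (hincl : S.comap (inclFunctor s t) = ⊤)
    (harc : ∀ j, S.comap (arcFunctor s t j) = ⊤) : S = ⊤ := by
  have htrack (z : Bridged s t) : pathClass ((stretchHomotopy s t).evalAt z) ∈ S.arrows _ _ := by
    induction z with
    | incl y =>
      have hy : pathClass (Path.refl y) ∈
          (S.comap (inclFunctor s t)).arrows _ _ :=
        hincl ▸ Subgroupoid.mem_top _
      exact pathClass_mem_of_apply_eq (fun _ => rfl) hy
    | arc j r =>
      let p : Path r (stretch r) := ⟨⟨_, Icc.continuous_convexComb r (stretch r)⟩, by simp, by simp⟩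
      have hp : pathClass p ∈ (S.comap (arcFunctor s t j)).arrows _ _ :=
        harc j ▸ Subgroupoid.mem_top _
      exact pathClass_mem_of_apply_eq (w' := p.map (continuous_arc j)) (fun _ => rfl) hp
  refine subgroupoid_eq_top_of_iUnion_eq_univ
    (U := fun o : Option J => o.elim (outer s t) fun j => arc s t j '' Ioo 0 1) ?_ ?_ ?_
  · rintro (_ | j)
    · exact isOpen_outer
    · rw [Option.elim_some, ← range_domRestrict]
      exact (isOpenEmbedding_arc_Ioo j).isOpen_range
  · rw [iUnion_option]
    exact outer_union_iUnion_arc_Ioo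
  · rintro (_ | j) a b w hw
    · refine (pathClass_mem_iff_map_mem _ htrack w).2
        (pathClass_mem_of_range_subset_range isInducing_incl hincl _ ?_)
      rintro _ ⟨u, rfl⟩
      exact stretchMap_mem_range_incl (hw (mem_range_self u))
    · let arcIoo : C(Ioo (0 : I) 1, Bridged s t) := (arcMap s t j).restrict _
      have harcIoo : S.comap (FundamentalGroupoid.map arcIoo) = ⊤ := by
        rw [show arcIoo = (arcMap s t j).comp ⟨_, continuous_subtype_val⟩ from rfl,
          FundamentalGroupoid.map_comp, Subgroupoid.comap_comp, Function.comp_apply, harc j]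
        rfl
      refine pathClass_mem_of_range_subset_range (isOpenEmbedding_arc_Ioo j).isInducing harcIoo w ?_
      exact hw.trans (range_domRestrict _ _).ge

end Generation

section BridgeLoop

variable {Y J : Type*} [TopologicalSpace Y] {s t : J → Y}

theorem arcFunctor_obj_zero (j : J) :
    (arcFunctor s t j).obj ⟨0⟩ = (inclFunctor s t).obj ⟨s j⟩ :=
  congrArg FundamentalGroupoid.mk (arc_zero j)

theorem arcFunctor_obj_one (j : J) :
    (arcFunctor s t j).obj ⟨1⟩ = (inclFunctor s t).obj ⟨t j⟩ :=
  congrArg FundamentalGroupoid.mk (arc_one j)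

variable (s t) in
/-- The class of the path along a bridge. -/
noncomputable def bridgeClass (j : J) :
    (inclFunctor s t).obj ⟨s j⟩ ⟶ (inclFunctor s t).obj ⟨t j⟩ :=
  eqToHom (arcFunctor_obj_zero j).symm ≫ (arcFunctor s t j).map (pathClass Path.id) ≫
    eqToHom (arcFunctor_obj_one j)

variable (T : Limits.Cone (inclFunctor s t))

/-- The loop at the apex of the cone `T` that runs once over a bridge. A cone `T` over the
fundamental groupoid of the original space is a choice of path classes from the apex to all points
of that space that is compatible with the paths in that space. -/
noncomputable def bridgeLoop (j : J) : End T.pt :=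
  T.π.app ⟨s j⟩ ≫ bridgeClass s t j ≫ Groupoid.inv (T.π.app ⟨t j⟩)

variable {T} in
theorem bridgeLoop_eq_one_iff {j : J} :
    bridgeLoop T j = 1 ↔ T.π.app ⟨s j⟩ ≫ bridgeClass s t j = T.π.app ⟨t j⟩ := by
  rw [bridgeLoop, ← Category.assoc, Groupoid.inv_eq_inv, End.one_def, IsIso.comp_inv_eq,
    Category.id_comp]

/-- The path class from the apex of `T` to the initial point of a bridge and then along it. -/
noncomputable def arcClass (j : J) (r : I) : T.pt ⟶ (arcFunctor s t j).obj ⟨r⟩ :=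
  T.π.app ⟨s j⟩ ≫ eqToHom (arcFunctor_obj_zero j).symm ≫
    (arcFunctor s t j).map (pathClass (PathConnectedSpace.somePath 0 r))

variable {T} {H : Subgroup (End T.pt)}

theorem arcClass_comp_map (j : J) {r r' : FundamentalGroupoid I} (q : r ⟶ r') :
    arcClass T j r.as ≫ (arcFunctor s t j).map q = arcClass T j r'.as := by
  rw [arcClass, Category.assoc, Category.assoc, ← Functor.map_comp,
    Subsingleton.elim (_ ≫ q) (pathClass (PathConnectedSpace.somePath 0 r'.as))]
  rfl

theorem arcClass_zero (j : J) :
    arcClass T j 0 = T.π.app ⟨s j⟩ ≫ eqToHom (arcFunctor_obj_zero j).symm := by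
  rw [arcClass, Subsingleton.elim (pathClass _) (𝟙 _), CategoryTheory.Functor.map_id,
    Category.comp_id]

theorem arcClass_one (j : J) : arcClass T j 1 =
    bridgeLoop T j ≫ T.π.app ⟨t j⟩ ≫ eqToHom (arcFunctor_obj_one j).symm := by
  rw [arcClass, bridgeLoop, bridgeClass,
    Subsingleton.elim (pathClass (PathConnectedSpace.somePath 0 1)) (pathClass Path.id)]
  simp [-FundamentalGroupoid.map_map]

/-- These are the fibres of the covering space associated with `H`: it is trivial over the original
space and over every bridge, and the hypothesis is what makes the pieces fit together. -/
theorem exists_endCoset_family (hH : ∀ j, bridgeLoop T j ∈ H) :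
    ∃ K : ∀ z : FundamentalGroupoid (Bridged s t), Set (T.pt ⟶ z),
      (∀ y, K ((inclFunctor s t).obj y) = endCoset H (T.π.app y)) ∧
        ∀ j r, K ((arcFunctor s t j).obj r) = endCoset H (arcClass T j r.as) := by
  refine ⟨fun z => Quot.hrecOn (motive := fun z => Set (T.pt ⟶ FundamentalGroupoid.mk z)) z.as
    (Sum.rec (fun y => endCoset H (T.π.app ⟨y⟩)) fun q => endCoset H (arcClass T q.1 q.2)) ?_,
    fun _ => rfl, fun _ _ => rfl⟩
  rintro _ _ (j | j)
  · refine endCoset_heq (arcFunctor_obj_zero j) ?_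
    have h : arcClass T j 0 ≫ eqToHom (arcFunctor_obj_zero j) ≫
        Groupoid.inv (T.π.app ⟨s j⟩) = 𝟙 T.pt := by
      simp [arcClass_zero]
    exact h ▸ H.one_mem
  · refine endCoset_heq (arcFunctor_obj_one j) ?_
    have h : arcClass T j 1 ≫ eqToHom (arcFunctor_obj_one j) ≫
        Groupoid.inv (T.π.app ⟨t j⟩) = bridgeLoop T j := by
      simp [arcClass_one]
    exact h ▸ hH j

theorem closure_range_bridgeLoop : Subgroup.closure (range (bridgeLoop T)) = ⊤ := by
  obtain ⟨K, hincl, harc⟩ :=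
    exists_endCoset_family fun j => Subgroup.subset_closure (mem_range_self (f := bridgeLoop T) j)
  have htransport : transporter K = ⊤ := by
    refine subgroupoid_eq_top ?_ fun j => ?_
    · refine top_unique ((Subgroupoid.le_iff _ _).2 fun {y y'} q _ p => ?_)
      rw [hincl, hincl, comp_mem_endCoset_iff (T.w q)]
    · refine top_unique ((Subgroupoid.le_iff _ _).2 fun {r r'} q _ p => ?_)
      rw [harc, harc, comp_mem_endCoset_iff (arcClass_comp_map j q)]
  refine top_unique fun g _ => ?_
  obtain ⟨y⟩ : Nonempty Y := by
    induction T.pt.as with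
    | incl y => exact ⟨y⟩
    | arc j _ => exact ⟨s j⟩
  have hmem : Groupoid.inv (T.π.app ⟨y⟩) ≫ g ≫ T.π.app ⟨y⟩ ∈ (transporter K).arrows _ _ :=
    htransport ▸ Subgroupoid.mem_top _
  have hg := (hmem (T.π.app ⟨y⟩)).2 (by rw [hincl]; exact self_mem_endCoset _)
  rw [hincl] at hg
  simpa [endCoset] using hg

theorem nonempty_apex_hom (z : FundamentalGroupoid (Bridged s t)) : Nonempty (T.pt ⟶ z) := by
  obtain ⟨z⟩ := z
  induction z with
  | incl y => exact ⟨T.π.app ⟨y⟩⟩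
  | arc j r => exact ⟨arcClass T j r⟩

theorem exists_zpowers_conj_eq_top {j₀ : J} (hj₀ : ∀ j ≠ j₀, bridgeLoop T j = 1)
    (z : FundamentalGroupoid (Bridged s t)) :
    ∃ c : T.pt ≅ z, Subgroup.zpowers (c.conj (bridgeLoop T j₀)) = ⊤ := by
  have hgen : Subgroup.zpowers (bridgeLoop T j₀) = ⊤ := by
    refine top_unique (closure_range_bridgeLoop.ge.trans ((Subgroup.closure_le _).2 ?_))
    rintro _ ⟨j, rfl⟩
    by_cases hj : j = j₀
    · exact hj ▸ Subgroup.mem_zpowers _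
    · exact hj₀ j hj ▸ Subgroup.one_mem _
  let c := (Groupoid.isoEquivHom _ _).symm (nonempty_apex_hom (T := T) z).some
  exact ⟨c, zpowers_apply_eq_top c.conj hgen⟩

end BridgeLoop

section ToCircle

variable {Y J : Type*} [TopologicalSpace Y] {s t : J → Y}

/-- The map to the circle that wraps the `j`-th bridge around the circle `c j` times and is
constant on the original space. -/
noncomputable def toCircle (c : J → ℤ) : C(Bridged s t, AddCircle (1 : ℝ)) where
  toFun := desc (fun _ => 0) (fun j r => ((c j * r : ℝ) : AddCircle (1 : ℝ)))
    (fun j => by simp) (fun j => by simp)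
  continuous_toFun := continuous_desc continuous_const fun j => by fun_prop

theorem winding_bridgeClass (c : J → ℤ) (j : J) :
    winding (toCircle c) (bridgeClass s t j) = c j := by
  let g : C(I, ℝ) := ⟨fun r => c j * r, by fun_prop⟩
  rw [bridgeClass, winding_comp, winding_comp, winding_eqToHom, winding_eqToHom, zero_add,
    add_zero, winding_map]
  exact (winding_coe_comp g _).trans (by simp [g])

theorem toCircle_comp_map {Y' J' : Type*} [TopologicalSpace Y'] {s' t' : J' → Y'} (c : J' → ℤ)
    (f : C(Y, Y')) (g : J → J') (hs : ∀ j, f (s j) = s' (g j)) (ht : ∀ j, f (t j) = t' (g j)) :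
    (toCircle c).comp (Bridged.map f g hs ht) = toCircle (c ∘ g) := by
  ext z
  induction z with
  | incl y => rfl
  | arc j r => rfl

theorem winding_app_of_comp_bridgeClass_eq {T : Limits.Cone (inclFunctor s t)} (c : J → ℤ) {j : J}
    (h : T.π.app ⟨s j⟩ ≫ bridgeClass s t j = T.π.app ⟨t j⟩) :
    winding (toCircle c) (T.π.app ⟨t j⟩) = winding (toCircle c) (T.π.app ⟨s j⟩) + c j := by
  rw [← h, winding_comp, winding_bridgeClass]

theorem exists_generator {T : Limits.Cone (inclFunctor s t)} {j₀ : J}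
    (hj₀ : ∀ j ≠ j₀, T.π.app ⟨s j⟩ ≫ bridgeClass s t j = T.π.app ⟨t j⟩) (c : J → ℤ)
    (z : FundamentalGroupoid (Bridged s t)) :
    ∃ k : End z, Subgroup.zpowers k = ⊤ ∧ winding (toCircle c) k =
      winding (toCircle c) (T.π.app ⟨s j₀⟩) + c j₀ - winding (toCircle c) (T.π.app ⟨t j₀⟩) := by
  obtain ⟨e, he⟩ :=
    exists_zpowers_conj_eq_top (fun j hj => bridgeLoop_eq_one_iff.2 (hj₀ j hj)) z
  refine ⟨_, he, ?_⟩
  rw [winding_conj, bridgeLoop, winding_comp, winding_comp, winding_inv, winding_bridgeClass,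
    ← add_sub_assoc']
  rfl

end ToCircle

end Bridged

section Generators

theorem nonempty_hom_iff_joined {Z : Type*} [TopologicalSpace Z] {x y : FundamentalGroupoid Z} :
    Nonempty (x ⟶ y) ↔ Joined x.as y.as :=
  nonempty_quotient_iff _

namespace Bridged

theorem exists_natTrans_const_inclFunctor {Y J V : Type*} [TopologicalSpace Y]
    [Quiver.IsThin (FundamentalGroupoid Y)] {s t : J → Y} {rep : V → Y}
    (hrep : ∀ y, ∃! v, Joined (rep v) y) {z : FundamentalGroupoid (Bridged s t)}
    (S : ∀ v, z ⟶ (inclFunctor s t).obj ⟨rep v⟩) :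
    ∃ τ : (Functor.const _).obj z ⟶ inclFunctor s t, ∀ v, τ.app ⟨rep v⟩ = S v :=
  exists_natTrans_const_of_isThin (rep := fun v => FundamentalGroupoid.mk (rep v))
    (fun y => by simpa only [nonempty_hom_iff_joined] using hrep y.as) _ S

end Bridged

open Bridged

variable {X : Type*} [TopologicalSpace X] [Quiver.IsThin (FundamentalGroupoid X)] {x₀ x₁ : X}

theorem exists_cone_X2 (hrep : ∀ x, ∃! v, Joined (![x₀, x₁] v) x) :
    ∃ T : Limits.Cone (inclFunctor (fun _ : BaseBridge => x₀) fun _ => x₁),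
      ∀ j ≠ .A, T.π.app ⟨x₀⟩ ≫ bridgeClass _ _ j = T.π.app ⟨x₁⟩ := by
  let F := inclFunctor (fun _ : BaseBridge => x₀) fun _ => x₁
  let β : F.obj ⟨x₀⟩ ⟶ F.obj ⟨x₁⟩ := bridgeClass _ _ .B
  let S : ∀ v, F.obj ⟨x₀⟩ ⟶ F.obj ⟨![x₀, x₁] v⟩
    | 0 => 𝟙 _
    | 1 => β
  obtain ⟨τ, hτ⟩ := exists_natTrans_const_inclFunctor hrep S
  have h₀ : τ.app ⟨x₀⟩ = 𝟙 _ := hτ 0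
  have h₁ : τ.app ⟨x₁⟩ = β := hτ 1
  have hB : τ.app ⟨x₀⟩ ≫ β = τ.app ⟨x₁⟩ := by
    rw [h₀, h₁]
    exact Category.id_comp β
  refine ⟨⟨_, τ⟩, ?_⟩
  rintro (_ | _) h
  exacts [(h rfl).elim, hB]

theorem exists_cone_X2Cover (hrep : ∀ x, ∃! v, Joined (![x₀, x₁] v) x) :
    ∃ T : Limits.Cone (inclFunctor (coverStart x₀) (coverEnd x₁)), ∀ j ≠ .A₀,
      T.π.app ⟨coverStart x₀ j⟩ ≫ bridgeClass _ _ j = T.π.app ⟨coverEnd x₁ j⟩ := by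
  let F := inclFunctor (coverStart x₀) (coverEnd x₁)
  let α₁ : F.obj ⟨(x₀, 1)⟩ ⟶ F.obj ⟨(x₁, 0)⟩ := bridgeClass (coverStart x₀) (coverEnd x₁) .A₁
  let β₀ : F.obj ⟨(x₀, 0)⟩ ⟶ F.obj ⟨(x₁, 0)⟩ := bridgeClass (coverStart x₀) (coverEnd x₁) .B₀
  let β₁ : F.obj ⟨(x₀, 1)⟩ ⟶ F.obj ⟨(x₁, 1)⟩ := bridgeClass (coverStart x₀) (coverEnd x₁) .B₁
  let S : ∀ w : Fin 2 × Fin 2, F.obj ⟨(x₀, 0)⟩ ⟶ F.obj ⟨(![x₀, x₁] w.1, w.2)⟩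
    | (0, 0) => 𝟙 _
    | (1, 0) => β₀
    | (0, 1) => β₀ ≫ Groupoid.inv α₁
    | (1, 1) => (β₀ ≫ Groupoid.inv α₁) ≫ β₁
  obtain ⟨τ, hτ⟩ := exists_natTrans_const_inclFunctor (existsUnique_joined_prod hrep) S
  have h₀₀ : τ.app ⟨(x₀, 0)⟩ = 𝟙 _ := hτ (0, 0)
  have h₁₀ : τ.app ⟨(x₁, 0)⟩ = β₀ := hτ (1, 0)
  have h₀₁ : τ.app ⟨(x₀, 1)⟩ = β₀ ≫ Groupoid.inv α₁ := hτ (0, 1)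
  have h₁₁ : τ.app ⟨(x₁, 1)⟩ = (β₀ ≫ Groupoid.inv α₁) ≫ β₁ := hτ (1, 1)
  have hA₁ : τ.app ⟨(x₀, 1)⟩ ≫ α₁ = τ.app ⟨(x₁, 0)⟩ := by
    rw [h₀₁, h₁₀, Category.assoc, Groupoid.inv_comp, Category.comp_id]
  have hB₀ : τ.app ⟨(x₀, 0)⟩ ≫ β₀ = τ.app ⟨(x₁, 0)⟩ := by
    rw [h₀₀, h₁₀]
    exact Category.id_comp β₀
  have hB₁ : τ.app ⟨(x₀, 1)⟩ ≫ β₁ = τ.app ⟨(x₁, 1)⟩ := by rw [h₀₁, h₁₁]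
  refine ⟨⟨_, τ⟩, ?_⟩
  rintro (_ | _ | _ | _) h
  exacts [(h rfl).elim, hA₁, hB₀, hB₁]

/-- The number of turns around the circle assigned to each bridge by the map `toCircle` that
detects generators. -/
def bridgeDegree : BaseBridge → ℤ
  | .A => 1
  | .B => 0

theorem exists_generator_X2 (hrep : ∀ x, ∃! v, Joined (![x₀, x₁] v) x)
    (b : FundamentalGroupoid (X2 x₀ x₁)) :
    ∃ k : End b, Subgroup.zpowers k = ⊤ ∧ winding (toCircle bridgeDegree) k = 1 := by
  obtain ⟨T, hT⟩ := exists_cone_X2 hrep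
  obtain ⟨k, hk, hwk⟩ := exists_generator hT bridgeDegree b
  have hB := winding_app_of_comp_bridgeClass_eq bridgeDegree (hT .B nofun)
  refine ⟨k, hk, ?_⟩
  rw [hwk, hB]
  simp [bridgeDegree]

theorem exists_generator_X2Cover (hrep : ∀ x, ∃! v, Joined (![x₀, x₁] v) x)
    (e : FundamentalGroupoid (X2Cover x₀ x₁)) :
    ∃ k : End e, Subgroup.zpowers k = ⊤ ∧
      winding (toCircle (bridgeDegree ∘ CoverBridge.proj)) k = 2 := by
  obtain ⟨T, hT⟩ := exists_cone_X2Cover hrep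
  let c := bridgeDegree ∘ CoverBridge.proj
  let w (y : X × Fin 2) : ℝ := winding (toCircle c) (T.π.app ⟨y⟩)
  have hw (j) (hj : j ≠ .A₀) : w (coverEnd x₁ j) = w (coverStart x₀ j) + c j :=
    winding_app_of_comp_bridgeClass_eq c (hT j hj)
  have hA₁ : w (x₁, 0) = w (x₀, 1) + (1 : ℤ) := hw .A₁ nofun
  have hB₀ : w (x₁, 0) = w (x₀, 0) + (0 : ℤ) := hw .B₀ nofun
  have hB₁ : w (x₁, 1) = w (x₀, 1) + (0 : ℤ) := hw .B₁ nofun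
  obtain ⟨k, hk, hwk⟩ := exists_generator hT c e
  have hA₀ : winding (toCircle c) k = w (x₀, 0) + (1 : ℤ) - w (x₁, 1) := hwk
  refine ⟨k, hk, ?_⟩
  push_cast at hA₀ hA₁ hB₀ hB₁
  linarith

end Generators

end AnomalousCover

open AnomalousCover in
theorem mainTheorem4_general {X : Type*} [TopologicalSpace X]
    (h_two : Nat.card (ZerothHomotopy X) = 2)
    (h_sc : ∀ x : X, SimplyConnectedSpace (pathComponent x))
    (x₀ x₁ : X) (h_ne : ¬ Joined x₀ x₁) :
    (∀ b : X2 x₀ x₁, Nonempty (FundamentalGroup (X2 x₀ x₁) b ≃* Multiplicative ℤ)) ∧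
    (∀ e : X2Cover x₀ x₁, Nonempty (FundamentalGroup (X2Cover x₀ x₁) e ≃* Multiplicative ℤ)) ∧
    (∀ (e : X2Cover x₀ x₁)
      (φ : FundamentalGroup (X2 x₀ x₁) (p1 x₀ x₁ e) ≃* Multiplicative ℤ),
      (FundamentalGroup.map (p1 x₀ x₁) e).range.map φ.toMonoidHom =
        Subgroup.zpowers (Multiplicative.ofAdd (2 : ℤ))) := by
  have := isThin_of_simplyConnectedSpace_pathComponent h_sc
  have hrep := existsUnique_joined_of_card_zerothHomotopy_eq_two h_two h_ne
  refine ⟨fun b => ?_, fun e => ?_, fun e φ => ?_⟩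
  · obtain ⟨k, hk, hwk⟩ := exists_generator_X2 hrep ⟨b⟩
    exact nonempty_mulEquiv_int hk (windingHom _ _) fun h => one_ne_zero (hwk.symm.trans h)
  · obtain ⟨l, hl, hwl⟩ := exists_generator_X2Cover hrep ⟨e⟩
    exact nonempty_mulEquiv_int hl (windingHom _ _) fun h => two_ne_zero (hwl.symm.trans h)
  · obtain ⟨k, hk, hwk⟩ := exists_generator_X2 hrep ⟨p1 x₀ x₁ e⟩
    obtain ⟨l, hl, hwl⟩ := exists_generator_X2Cover hrep ⟨e⟩
    obtain ⟨n, hn : k ^ n = FundamentalGroup.map (p1 x₀ x₁) e l⟩ :=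
      Subgroup.mem_zpowers_iff.1 (hk ▸ Subgroup.mem_top _)
    have hw : winding (Bridged.toCircle bridgeDegree) (k ^ n) = 2 := by
      have hp : (Bridged.toCircle bridgeDegree).comp (p1 x₀ x₁) =
          Bridged.toCircle (bridgeDegree ∘ CoverBridge.proj) :=
        Bridged.toCircle_comp_map _ _ _ _ _
      rw [hn, ← hwl, ← hp]
      exact winding_map _ l
    obtain rfl : n = 2 := by
      rw [winding_zpow, hwk, mul_one] at hw
      exact_mod_cast hw
    rw [MonoidHom.range_eq_map, ← hl, MonoidHom.map_zpowers, ← hn]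
    exact map_zpowers_zpow_eq hk φ 2

open AnomalousCover in
theorem mainTheorem4 {X : Type*} [TopologicalSpace X] [ConnectedSpace X]
    (h_two : Nat.card (ZerothHomotopy X) = 2)
    (h_sc : ∀ x : X, SimplyConnectedSpace (pathComponent x))
    (h_lpc : ∀ x : X, LocallyPathConnectedSpace (pathComponent x))
    (x₀ x₁ : X) (h_ne : ¬ Joined x₀ x₁) :
    (∀ b : X2 x₀ x₁, Nonempty (FundamentalGroup (X2 x₀ x₁) b ≃* Multiplicative ℤ)) ∧
    (∀ e : X2Cover x₀ x₁, Nonempty (FundamentalGroup (X2Cover x₀ x₁) e ≃* Multiplicative ℤ)) ∧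
    (∀ (e : X2Cover x₀ x₁)
      (φ : FundamentalGroup (X2 x₀ x₁) (p1 x₀ x₁ e) ≃* Multiplicative ℤ),
      (FundamentalGroup.map (p1 x₀ x₁) e).range.map φ.toMonoidHom =
        Subgroup.zpowers (Multiplicative.ofAdd (2 : ℤ))) :=
  mainTheorem4_general h_two h_sc x₀ x₁ h_ne
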